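/- Let $G$ be a countable discrete group and write $\mathbb{T}=\mathbb{R}/\mathbb{Z}$. Let $f=\sum_g f_g\,g\in\mathbb{Z}(G)$ be semi-lopsided, i.e. $f_1>0$ and $\sum_{g\neq 1}|f_g|\le f_1$. Suppose that $f$ has an $\ell^2$ formal inverse $\xi$, i.e. $\xi\in\ell^2(G,\mathbb{R})$ and $\xi f=\delta_1$, where $(\xi f)(g)=\sum_h \xi(gh^{-1})f_h$. Let $S=\{g\in G: g\neq 1,\ f_g\neq 0\}$. Suppose that the subgroup $H=\langle S\rangle$ has a left-invariant partial order $\preceq$ such that $s\succ 1$ for every $s\in S$, and that the group $\langle a^{-1}b : a,b\in S\rangle$ is infinite. Let $X_f$ be the Pontryagin dual of $\mathbb{Z}(G)/\mathbb{Z}(G)f$, viewed as the closed subgroup of $\mathbb{T}^G$ consisting of all $\theta$ with $\sum_g\alpha_g\theta(g)=0$ for every $\alpha\in\mathbb{Z}(G)f$. Let $m_{X_f}$ be its Haar probability measure, and let $G$ act by $(g\theta)(h)=\theta(g^{-1}h)$ (the same formula defines the action of $G$ on $A^G$ for any set $A$). Then there is a mean-zero probability measure $\nu$ supported on a finite subset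 of $\mathbb{Z}$ for which the following holds. There is a unique map $\eta\mapsto\Theta_\eta$ from $\ell^2(G,\mathbb{R})$ to the space of $\nu^{\otimes G}$-a.e. classes of measurable maps $\mathbb{R}^G\to\mathbb{T}^G$ that is continuous from the $\ell^2$-norm to the topology of convergence in measure and satisfies, for every finitely supported $\eta$, $\Theta_\eta(x)(g)=(x\eta^*)(g)+\mathbb{Z}$ for almost every $x$ and all $g\in G$, where $\eta^*(h)=\eta(h^{-1})$ and $(x\eta^*)(g)=\sum_h x(gh^{-1})\eta^*(h)$. For this map, $\Theta_\xi$ is almost everywhere $G$-equivariant and $(\Theta_\xi)_*(\nu^{\otimes G})=m_{X_f}$ (as measures on $\mathbb{T}^G$). Consequently $G\curvearrowright(X_f,m_{X_f})$ is a factor of a Bernoulli shift: there are a standard Borel probability space $(A,\kappa)$ and a measure-preserving, almost everywhere $G$-equivariant map $(A^G,\kappa^{\otimes G})\to(X_f,m_{X_f})$. -/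

import Mathlib

open MeasureTheory Filter Topology
open scoped ENNReal

noncomputable section

namespace AlgAction

/-! Throughout, `𝕋 = ℝ / ℤ` is `UnitAddCircle` and `ℤ(G)` is `MonoidAlgebra ℤ G`. -/

/-- The pairing `⟨θ, α⟩ = ∑_g α_g θ(g)` of `θ ∈ 𝕋^G` with `α ∈ ℤ(G)`. -/
def pairing {G : Type*} (θ : G → UnitAddCircle) (α : MonoidAlgebra ℤ G) : UnitAddCircle :=
  ∑ g ∈ α.coeff.support, α.coeff g • θ g

theorem pairing_eq {G : Type*} (θ : G → UnitAddCircle) (α : MonoidAlgebra ℤ G) :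
    pairing θ α = Finsupp.liftAddHom (fun g => (zmultiplesHom UnitAddCircle) (θ g)) α.coeff := by
  simp [pairing, Finsupp.sum]

section Defs

variable {G : Type*} [Group G]

/-! ### Elements of the integral group ring -/

/-- `f` is semi-lopsided: `f₁ > 0` and `∑_{g ≠ 1} |f_g| ≤ f₁`. -/
def IsSemiLopsided (f : MonoidAlgebra ℤ G) : Prop :=
  0 < f.coeff 1 ∧ ∑ᶠ (g : G) (_ : g ≠ 1), |f.coeff g| ≤ f.coeff 1

/-- The nonidentity support `S = supp(f) \ {1}`. -/
def nonidSupport (f : MonoidAlgebra ℤ G) : Set G :=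
  {g : G | f.coeff g ≠ 0} \ {1}

/-- The convolution `(x η)(g) = ∑_h x(g h⁻¹) η(h)` of a function `x : G → ℝ` with a finitely
supported function `η : G → ℝ`. -/
def rconv (x η : G → ℝ) (g : G) : ℝ :=
  ∑ᶠ h : G, x (g * h⁻¹) * η h

/-- `ξ ∈ ℓ²(G, ℝ)` is an `ℓ²` formal inverse of `f ∈ ℤ(G)`: the convolution `ξ f` is `δ₁`. -/
def IsL2FormalInverse (f : MonoidAlgebra ℤ G) (ξ : lp (fun _ : G => ℝ) 2) : Prop :=
  rconv (fun g => ξ g) (fun g => (f.coeff g : ℝ)) = Set.indicator {1} (fun _ => (1 : ℝ))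

/-- The subgroup `⟨S⟩` generated by `S` carries a left-invariant partial order for which every
element of `S` is strictly larger than `1`. -/
def HasPositiveLeftOrder (S : Set G) : Prop :=
  ∃ o : PartialOrder (Subgroup.closure S),
    (∀ a b c : Subgroup.closure S, o.le a b → o.le (c * a) (c * b)) ∧
    ∀ s : Subgroup.closure S, (s : G) ∈ S → o.lt 1 s

/-! ### Shifts and Bernoulli shifts -/

/-- The left shift `(g x)(h) = x(g⁻¹ h)` on `A^G`. -/
def shift {A : Type*} (g : G) (x : G → A) : G → A := fun h => x (g⁻¹ * h)

/-- The measure `κ^{⊗ G}` on `A^G`. -/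
abbrev bernoulli (G : Type*) {A : Type*} [MeasurableSpace A] (κ : Measure A) :
    Measure (G → A) :=
  Measure.infinitePi fun _ : G => κ

/-- The action of `G` on `(Y, μ)` is a factor of a Bernoulli shift: for some standard Borel
probability space `(A, κ)` there is a measure-preserving, almost everywhere `G`-equivariant map
`(A^G, κ^{⊗ G}) → (Y, μ)`. -/
def IsFactorOfBernoulli (G : Type*) [Group G] {Y : Type*} [MeasurableSpace Y] [MulAction G Y]
    (μ : Measure Y) : Prop :=
  ∃ (A : Type) (_ : MeasurableSpace A) (_ : StandardBorelSpace A) (κ : Measure A)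
    (_ : IsProbabilityMeasure κ) (φ : (G → A) → Y),
    MeasurePreserving φ (bernoulli G κ) μ ∧
    ∀ g : G, ∀ᵐ x ∂(bernoulli G κ), φ (shift g x) = g • φ x

/-! ### The algebraic action `G ↷ X_f` -/

/-- The pairing with a fixed `θ`, as a homomorphism `ℤ(G) → 𝕋`. -/
def pairingHom (θ : G → UnitAddCircle) : MonoidAlgebra ℤ G →+ UnitAddCircle where
  toFun := pairing θ
  map_zero' := by simp [pairing]
  map_add' a b := by
    have key := fun c : MonoidAlgebra ℤ G => pairing_eq θ c
    simp only [key, MonoidAlgebra.coeff_add, map_add]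

theorem pairingHom_single (θ : G → UnitAddCircle) (g : G) (n : ℤ) :
    pairingHom θ (MonoidAlgebra.single g n) = n • θ g := by
  change pairing θ _ = _
  rw [pairing_eq]
  simp

/-- `X_f`, the Pontryagin dual of `ℤ(G) / ℤ(G) f`, realised inside `𝕋^G` (the dual of `ℤ(G)` under
the pairing above) as the annihilator of the left ideal `ℤ(G) f`. -/
def X (f : MonoidAlgebra ℤ G) : AddSubgroup (G → UnitAddCircle) where
  carrier := {θ | ∀ α ∈ Ideal.span {f}, pairing θ α = 0}
  zero_mem' := by intro α _; simp [pairing]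
  add_mem' := by
    intro a b ha hb α hα
    have h1 := ha α hα
    have h2 := hb α hα
    simp only [pairing] at h1 h2 ⊢
    simp [smul_add, Finset.sum_add_distrib, h1, h2]
  neg_mem' := by
    intro a ha α hα
    have h1 := ha α hα
    simp only [pairing] at h1 ⊢
    simp [h1]

/-- `θ ∈ X_f` exactly when `g ↦ θ(g)` comes from a homomorphism `ℤ(G) / ℤ(G) f → 𝕋`. -/
theorem mem_X_iff_exists_hom (f : MonoidAlgebra ℤ G) (θ : G → UnitAddCircle) :
    θ ∈ X f ↔ ∃ χ : (MonoidAlgebra ℤ G ⧸ Ideal.span {f}) →+ UnitAddCircle,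
      ∀ g : G, χ (Submodule.Quotient.mk (MonoidAlgebra.single g 1)) = θ g := by
  constructor
  · intro h
    refine ⟨QuotientAddGroup.lift (Submodule.toAddSubgroup (Ideal.span {f})) (pairingHom θ)
      (fun α hα => h α hα), fun g => ?_⟩
    have := pairingHom_single θ g 1
    rw [one_smul] at this
    exact this
  · rintro ⟨χ, hχ⟩ α hα
    have key : pairingHom θ =
        χ.comp (Submodule.mkQ (Ideal.span {f})).toAddMonoidHom := by
      refine MonoidAlgebra.addMonoidHom_ext fun g n => ?_
      rw [pairingHom_single, ← hχ g, ← map_zsmul]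
      change _ = χ (Submodule.Quotient.mk _)
      rw [← Submodule.Quotient.mk_smul]
      simp
    change pairingHom θ α = 0
    rw [key]
    change χ (Submodule.Quotient.mk α) = 0
    rw [(Submodule.Quotient.mk_eq_zero _).2 hα, map_zero]

theorem pairing_shift (g : G) (θ : G → UnitAddCircle) (α : MonoidAlgebra ℤ G) :
    pairing (shift g θ) α = pairing θ (MonoidAlgebra.single g⁻¹ 1 * α) := by
  have key : pairingHom (shift g θ) =
      (pairingHom θ).comp (AddMonoidHom.mulLeft (MonoidAlgebra.single g⁻¹ 1)) := by
    refine MonoidAlgebra.addMonoidHom_ext fun h n => ?_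
    rw [AddMonoidHom.comp_apply, AddMonoidHom.coe_mulLeft, MonoidAlgebra.single_mul_single,
      pairingHom_single, pairingHom_single, one_mul]
    rfl
  exact DFunLike.congr_fun key α

theorem shift_mem_X (f : MonoidAlgebra ℤ G) (g : G) {θ : G → UnitAddCircle} (h : θ ∈ X f) :
    shift g θ ∈ X f := by
  intro α hα
  rw [pairing_shift]
  exact h _ (Ideal.mul_mem_left _ _ hα)

/-- `G` acts on `X_f` by the left shift. -/
instance instMulActionX (f : MonoidAlgebra ℤ G) : MulAction G (X f) where
  smul g θ := ⟨shift g θ.1, shift_mem_X f g θ.2⟩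
  one_smul θ := by
    apply Subtype.ext; funext h
    change θ.1 (1⁻¹ * h) = θ.1 h
    simp
  mul_smul a b θ := by
    apply Subtype.ext; funext h
    change θ.1 ((a * b)⁻¹ * h) = θ.1 (b⁻¹ * (a⁻¹ * h))
    simp [mul_assoc]

theorem isClosed_X (f : MonoidAlgebra ℤ G) :
    IsClosed ((X f : AddSubgroup (G → UnitAddCircle)) : Set (G → UnitAddCircle)) := by
  have : ((X f : AddSubgroup (G → UnitAddCircle)) : Set (G → UnitAddCircle)) =
      ⋂ α ∈ Ideal.span {f}, {θ | pairing θ α = 0} := by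
    ext θ; simp [X]
  rw [this]
  refine isClosed_biInter fun α _ => isClosed_eq ?_ continuous_const
  unfold pairing
  fun_prop

instance instCompactSpaceX (f : MonoidAlgebra ℤ G) : CompactSpace (X f) :=
  isCompact_iff_compactSpace.1 (isClosed_X f).isCompact

/-- The Haar probability measure `m_{X_f}` of the compact group `X_f`. -/
def haarX [Countable G] (f : MonoidAlgebra ℤ G) : Measure (X f) :=
  Measure.addHaarMeasure ⊤

/-! ### The `ℓ²`-convolution map -/

/-- The defining properties of the map
`ℓ²(G, ℝ) → Meas(ℝ^G, ν^{⊗ G}, 𝕋^G)`, `ξ ↦ Θ_ξ`: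
it is `x ↦ x ξ^* mod ℤ` for finitely supported `ξ`, where `ξ^*(h) = ξ(h⁻¹)`, and it is continuous
from the `ℓ²`-norm to the topology of convergence in measure. -/
def IsL2Convolution [Countable G] (ν : Measure ℝ)
    (Θ : lp (fun _ : G => ℝ) 2 → ((G → ℝ) →ₘ[bernoulli G ν] (G → UnitAddCircle))) : Prop :=
  (∀ ξ : lp (fun _ : G => ℝ) 2, (Function.support fun g => ξ g).Finite →
    ∀ᵐ x ∂(bernoulli G ν), ∀ g : G,
      Θ ξ x g = ((rconv x (fun h => ξ h⁻¹) g : ℝ) : UnitAddCircle)) ∧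
  (∀ ξ : lp (fun _ : G => ℝ) 2, ∀ V ∈ uniformity (G → UnitAddCircle),
    Tendsto (fun η => bernoulli G ν {x | (Θ η x, Θ ξ x) ∉ V}) (𝓝 ξ) (𝓝 0))

end Defs

end AlgAction

end

/-! Put n = f₁ and let P be the monoid generated by S. The order forces P ∩ P⁻¹ = {1}, so "a⁻¹b ∈ P"
is a left-invariant partial order on all of G. A maximum principle (`eq_zero_of_subharmonic`) makes
right multiplication by f injective on functions vanishing at infinity. It follows that ξ is
supported in P, that ξ(1) = 1/n, and that fξ = δ₁ as well as ξf = δ₁.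

Pairing Θ_ξ(x) with α ∈ ℤ(G) gives ∑_u (αξ)(u) x(u) mod ℤ. If α = γf, then αξ = γ is integral and
finitely supported, and x is integer-valued, so the pairing vanishes: Θ_ξ takes values in X_f. If α
∉ ℤ(G)f, independence makes the Fourier coefficient at α vanish as soon as one factor ν̂((αξ)(u))
does. The algebraic core, `exists_lconv_mul_eq_intCast`, finds u with (αξ)(u) ∈ (1/n)ℤ \ ℤ. Taking ν
to be the law of the difference of two independent uniform variables on {0, …, 2n−1} makes ν̂ vanish
at all such points. Hence the law of Θ_ξ has the Fourier coefficients of Haar measure, and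
`eq_map_haarX` identifies it. -/

noncomputable section

namespace AlgAction

/-! ### Pointed sets, the maximum principle, and convolution with the group ring. -/

section GroupRing

variable {G : Type*} [Group G]

/-- A set is pointed if the submonoid it generates contains no nontrivial
element together with its inverse. -/
def IsPointed (S : Set G) : Prop :=
  ∀ p ∈ Submonoid.closure S, p⁻¹ ∈ Submonoid.closure S → p = 1

/-- Left invariance makes every product of elements of S at least 1. If p⁻¹ is such a product too,
multiplying 1 ≤ p⁻¹ by p gives p ≤ 1 ≤ p. -/
theorem HasPositiveLeftOrder.isPointed {S : Set G} (h : HasPositiveLeftOrder S) :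
    IsPointed S := by
  obtain ⟨o, hmul, hpos⟩ := h
  have key : ∀ p ∈ Submonoid.closure S, ∃ hp : p ∈ Subgroup.closure S, o.le 1 ⟨p, hp⟩ := by
    intro p hp
    induction hp using Submonoid.closure_induction with
    | mem x hx => exact ⟨Subgroup.subset_closure hx, le_of_lt (hpos ⟨x, _⟩ hx)⟩
    | one => exact ⟨one_mem _, o.le_refl _⟩
    | mul x y _ _ ihx ihy =>
      obtain ⟨hx, hx'⟩ := ihx
      obtain ⟨hy, hy'⟩ := ihy
      refine ⟨mul_mem hx hy, o.le_trans _ _ _ hx' ?_⟩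
      have := hmul 1 ⟨y, hy⟩ ⟨x, hx⟩ hy'
      rwa [mul_one] at this
  intro p hp hp'
  obtain ⟨h1, h2⟩ := key p hp
  obtain ⟨h3, h4⟩ := key _ hp'
  have := hmul 1 ⟨p⁻¹, h3⟩ ⟨p, h1⟩ h4
  rw [mul_one] at this
  have h5 : (⟨p, h1⟩ * ⟨p⁻¹, h3⟩ : Subgroup.closure S) = 1 := Subtype.ext (mul_inv_cancel p)
  rw [h5] at this
  exact congrArg Subtype.val (o.le_antisymm _ _ this h2)

/-- Nonempty finite sets have minimal elements for the left-invariant order defined by a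
pointed set. -/
theorem IsPointed.exists_minimal {S : Set G} (hS : IsPointed S) {T : Set G} (hT : T.Finite)
    (hne : T.Nonempty) : ∃ m ∈ T, ∀ t ∈ T, t⁻¹ * m ∈ Submonoid.closure S → t = m := by
  -- Pointedness is precisely antisymmetry of this relation.
  let o : PartialOrder G :=
    { le := fun a b => a⁻¹ * b ∈ Submonoid.closure S
      le_refl := fun a => by simp
      le_trans := fun a b c hab hbc => by
        have := mul_mem hab hbc
        simpa [mul_assoc] using this
      le_antisymm := fun a b hab hba => by
        have := hS _ hab (by simpa using hba)
        exact (inv_mul_eq_one.1 this) }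
  obtain ⟨m, hm⟩ := hT.exists_minimal hne
  exact ⟨m, hm.1, fun t ht h => le_antisymm (α := G) h (hm.2 ht h)⟩

theorem IsSemiLopsided.sum_le {f : MonoidAlgebra ℤ G} (hf : IsSemiLopsided f) [DecidableEq G] :
    ∑ s ∈ f.coeff.support.erase 1, |(f.coeff s : ℝ)| ≤ f.coeff 1 := by
  have h := hf.2
  rw [show (∑ᶠ (g : G) (_ : g ≠ 1), |f.coeff g|) =
    ∑ s ∈ f.coeff.support.erase 1, |f.coeff s| from
    finsum_mem_eq_sum_of_inter_support_eq (s := {g | g ≠ 1}) _ (by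
      ext g; simp +contextual)] at h
  exact_mod_cast h

theorem IsSemiLopsided.pos {f : MonoidAlgebra ℤ G} (hf : IsSemiLopsided f) :
    (0 : ℝ) < f.coeff 1 := by exact_mod_cast hf.1

/-- Maximum principle for subharmonic functions vanishing at infinity. -/
theorem eq_zero_of_subharmonic [DecidableEq G] {f : MonoidAlgebra ℤ G} (hf : IsSemiLopsided f)
    (hS : IsPointed (nonidSupport f)) {ζ : G → ℝ} (hζ : Tendsto ζ cofinite (𝓝 0))
    (h : ∀ g, ζ g ≠ 0 → f.coeff 1 * |ζ g| ≤
      ∑ s ∈ f.coeff.support.erase 1, |(f.coeff s : ℝ)| * |ζ (g * s⁻¹)|) (g : G) : ζ g = 0 := by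
  by_contra hg
  have hfin : ∀ c > 0, {x | c ≤ |ζ x|}.Finite := by
    intro c hc
    have := (hζ.abs).eventually (gt_mem_nhds (by simpa using hc))
    simpa [Filter.eventually_cofinite] using this
  obtain ⟨g₁, hg₁, hmax⟩ := (hfin _ (abs_pos.2 hg)).exists_maximalFor (fun x => |ζ x|) _ ⟨g, le_refl |ζ g|⟩
  have hmax' : ∀ x, |ζ x| ≤ |ζ g₁| := by
    intro x
    by_contra! hx
    exact absurd (hmax (le_trans hg₁ hx.le) hx.le) (not_le.2 hx)
  have hM : 0 < |ζ g₁| := (abs_pos.2 hg).trans_le hg₁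
  -- Among the finitely many points where |ζ| is maximal, take a minimal one for the order. The
  -- points m s⁻¹ lie strictly below it, so |ζ| is strictly smaller there; this gives a
  -- contradiction even when ∑|f_s| = f₁.
  obtain ⟨m, hm, hmin⟩ := hS.exists_minimal (hfin _ hM) ⟨g₁, le_refl |ζ g₁|⟩
  have hm' : |ζ m| = |ζ g₁| := le_antisymm (hmax' m) hm
  have hlt : ∀ s ∈ f.coeff.support.erase 1, |ζ (m * s⁻¹)| < |ζ g₁| := by
    intro s hs
    rw [Finset.mem_erase, Finsupp.mem_support_iff] at hs
    by_contra! hle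
    have := hmin (m * s⁻¹) hle (by
      simpa using Submonoid.subset_closure (show s ∈ nonidSupport f from ⟨hs.2, hs.1⟩))
    simp at this
    exact hs.1 this
  have hm0 := h m (abs_pos.1 (hm' ▸ hM))
  rw [hm'] at hm0
  rcases (f.coeff.support.erase 1).eq_empty_or_nonempty with he | hne
  -- For S empty no strict comparison of sums is available, but the bound already reads f₁ · max|ζ|
  -- ≤ 0.
  · rw [he, Finset.sum_empty] at hm0
    exact absurd hm0 (not_le.2 (mul_pos hf.pos hM))
  · have h1 : ∑ s ∈ f.coeff.support.erase 1, |(f.coeff s : ℝ)| * |ζ (m * s⁻¹)| <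
        ∑ s ∈ f.coeff.support.erase 1, |(f.coeff s : ℝ)| * |ζ g₁| := by
      refine Finset.sum_lt_sum_of_nonempty hne fun s hs => ?_
      have : (f.coeff s : ℝ) ≠ 0 := by
        exact_mod_cast Finsupp.mem_support_iff.1 (Finset.mem_of_mem_erase hs)
      exact mul_lt_mul_of_pos_left (hlt s hs) (abs_pos.2 this)
    rw [← Finset.sum_mul] at h1
    have h2 := mul_le_mul_of_nonneg_right hf.sum_le hM.le
    linarith

/-- The right convolution of a function with an element of the group ring. -/
theorem rconv_eq_sum (x : G → ℝ) (f : MonoidAlgebra ℤ G) (g : G) :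
    rconv x (fun h => (f.coeff h : ℝ)) g =
      ∑ h ∈ f.coeff.support, (f.coeff h : ℝ) * x (g * h⁻¹) := by
  rw [rconv, finsum_eq_sum_of_support_subset (s := f.coeff.support)]
  · exact Finset.sum_congr rfl fun h _ => mul_comm _ _
  · intro h; simp +contextual

theorem rconv_eq_add [DecidableEq G] (x : G → ℝ) {f : MonoidAlgebra ℤ G}
    (hf : f.coeff 1 ≠ 0) (g : G) :
    rconv x (fun h => (f.coeff h : ℝ)) g = (f.coeff 1 : ℝ) * x g +
      ∑ s ∈ f.coeff.support.erase 1, (f.coeff s : ℝ) * x (g * s⁻¹) := by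
  rw [rconv_eq_sum, ← Finset.add_sum_erase _ _ (Finsupp.mem_support_iff.2 hf)]
  simp

/-- The right multiplication by a semi-lopsided element is injective on functions vanishing at
infinity. -/
theorem eq_zero_of_rconv_eq_zero {f : MonoidAlgebra ℤ G} (hf : IsSemiLopsided f)
    (hS : IsPointed (nonidSupport f)) {ζ : G → ℝ} (hζ : Tendsto ζ cofinite (𝓝 0))
    (h : ∀ g, rconv ζ (fun h => (f.coeff h : ℝ)) g = 0) (g : G) : ζ g = 0 := by
  classical
  refine eq_zero_of_subharmonic hf hS hζ (fun g _ => ?_) g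
  have h1 := h g
  rw [rconv_eq_add ζ hf.1.ne'] at h1
  rw [← abs_of_pos hf.pos, ← abs_mul, eq_neg_of_add_eq_zero_left h1, abs_neg]
  refine (Finset.abs_sum_le_sum_abs _ _).trans_eq ?_
  simp [abs_mul]

/-- The left convolution `α ξ` of a function with an element of the group ring. -/
def lconv (α : MonoidAlgebra ℤ G) (ξ : G → ℝ) (u : G) : ℝ :=
  ∑ g ∈ α.coeff.support, (α.coeff g : ℝ) * ξ (g⁻¹ * u)

/-- The left convolution as an additive map of the group ring element. -/
def lconvHom (ξ : G → ℝ) (u : G) : MonoidAlgebra ℤ G →+ ℝ where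
  toFun α := lconv α ξ u
  map_zero' := by simp [lconv]
  map_add' a b := by
    classical
    have key (c : MonoidAlgebra ℤ G) : lconv c ξ u =
        c.coeff.sum (fun g n => (n : ℝ) * ξ (g⁻¹ * u)) := rfl
    rw [key, key, key, MonoidAlgebra.coeff_add, Finsupp.sum_add_index' (by simp)]
    intro a b c; push_cast; ring

theorem lconv_single (ξ : G → ℝ) (u g : G) (n : ℤ) :
    lconv (MonoidAlgebra.single g n) ξ u = n * ξ (g⁻¹ * u) := by
  have : lconv (MonoidAlgebra.single g n) ξ u =
        (Finsupp.single g n).sum (fun g n => (n : ℝ) * ξ (g⁻¹ * u)) := rfl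
  rw [this, Finsupp.sum_single_index (by simp)]

theorem lconv_sub (α β : MonoidAlgebra ℤ G) (ξ : G → ℝ) (u : G) :
    lconv (α - β) ξ u = lconv α ξ u - lconv β ξ u := map_sub (lconvHom ξ u) α β

theorem lconv_single_mul (α : MonoidAlgebra ℤ G) (ξ : G → ℝ) (u g : G) (n : ℤ) :
    lconv (MonoidAlgebra.single g n * α) ξ u = n * lconv α ξ (g⁻¹ * u) := by
  have key : (lconvHom ξ u).comp (AddMonoidHom.mulLeft (MonoidAlgebra.single g n)) =
      (AddMonoidHom.mulLeft (n : ℝ)).comp (lconvHom ξ (g⁻¹ * u)) := by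
    refine MonoidAlgebra.addMonoidHom_ext fun h m => ?_
    change lconv (MonoidAlgebra.single g n * MonoidAlgebra.single h m) ξ u =
      n * lconv (MonoidAlgebra.single h m) ξ (g⁻¹ * u)
    rw [MonoidAlgebra.single_mul_single, lconv_single, lconv_single]
    push_cast
    rw [mul_inv_rev, mul_assoc, mul_assoc]
  exact DFunLike.congr_fun key α

/-- This is (γf)ξ = γ(fξ) = γ; both sides are additive in γ, so monomials suffice. -/
theorem lconv_mul_of_lconv_eq [DecidableEq G] {f : MonoidAlgebra ℤ G} {ξ : G → ℝ}
    (h : ∀ u, lconv f ξ u = if u = 1 then 1 else 0) (γ : MonoidAlgebra ℤ G) (u : G) :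
    lconv (γ * f) ξ u = γ.coeff u := by
  have key : (lconvHom ξ u).comp (AddMonoidHom.mulRight f) =
      ((Int.castAddHom ℝ).comp (Finsupp.applyAddHom u)).comp
        (MonoidAlgebra.coeffAddEquiv (R := ℤ) (M := G)).toAddMonoidHom := by
    refine MonoidAlgebra.addMonoidHom_ext fun g n => ?_
    change lconv (MonoidAlgebra.single g n * f) ξ u =
      (((MonoidAlgebra.single g n : MonoidAlgebra ℤ G).coeff u : ℤ) : ℝ)
    rw [lconv_single_mul, h, MonoidAlgebra.coeff_single, Finsupp.single_apply]
    simp only [inv_mul_eq_one]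
    split_ifs <;> simp
  exact DFunLike.congr_fun key γ

end GroupRing

/-! ### Structure of the formal inverse, and nonintegral values of αξ. -/

section Inverse

variable {G : Type*} [Group G] {f : MonoidAlgebra ℤ G} {ξ : G → ℝ}

/-- If g ∉ P and s ∈ S then gs⁻¹ ∉ P, so the recursion ξf = δ₁ off P involves only values off P. The
maximum principle therefore applies to ξ set to zero on P. -/
theorem eq_zero_of_notMem_closure (hf : IsSemiLopsided f) (hS : IsPointed (nonidSupport f))
    (hξ0 : Tendsto ξ cofinite (𝓝 0))
    (hξ : rconv ξ (fun g => (f.coeff g : ℝ)) = Set.indicator {1} (fun _ => (1 : ℝ)))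
    {g : G} (hg : g ∉ Submonoid.closure (nonidSupport f)) : ξ g = 0 := by
  classical
  set P := Submonoid.closure (nonidSupport f)
  have key : ∀ g, (if g ∈ P then 0 else ξ g) = 0 := by
    refine eq_zero_of_subharmonic hf hS ?_ fun g hg => ?_
    · refine squeeze_zero_norm (a := fun g => ‖ξ g‖) (fun g => ?_) (by simpa using hξ0.norm)
      split_ifs <;> simp
    · have hgP : g ∉ P := by
        intro h; simp [h] at hg
      have h1 := congrFun hξ g
      rw [rconv_eq_add ξ hf.1.ne', Set.indicator_of_notMem] at h1
      · rw [if_neg hgP, ← abs_of_pos hf.pos, ← abs_mul, eq_neg_of_add_eq_zero_left h1, abs_neg]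
        refine (Finset.abs_sum_le_sum_abs _ _).trans_eq (Finset.sum_congr rfl fun s hs => ?_)
        have hsP : s ∈ P := by
          rw [Finset.mem_erase, Finsupp.mem_support_iff] at hs
          exact Submonoid.subset_closure ⟨hs.2, hs.1⟩
        rw [if_neg, abs_mul]
        intro h
        exact hgP (by simpa using mul_mem h hsP)
      · rintro rfl
        exact hgP (one_mem _)
  simpa [hg] using key g

/-- Evaluate ξf = δ₁ at 1: the other terms involve ξ(s⁻¹), and s⁻¹ ∉ P by pointedness. -/
theorem coeff_one_mul_eq_one (hf : IsSemiLopsided f) (hS : IsPointed (nonidSupport f))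
    (hξ0 : Tendsto ξ cofinite (𝓝 0))
    (hξ : rconv ξ (fun g => (f.coeff g : ℝ)) = Set.indicator {1} (fun _ => (1 : ℝ))) :
    f.coeff 1 * ξ 1 = 1 := by
  classical
  have h1 := congrFun hξ 1
  rw [rconv_eq_add ξ hf.1.ne', Finset.sum_eq_zero, add_zero] at h1
  · simpa using h1
  · intro s hs
    rw [Finset.mem_erase, Finsupp.mem_support_iff] at hs
    have hsP : s ∈ Submonoid.closure (nonidSupport f) := Submonoid.subset_closure ⟨hs.2, hs.1⟩
    rw [one_mul, eq_zero_of_notMem_closure hf hS hξ0 hξ, mul_zero]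
    exact fun h => hs.1 (hS s hsP h)

theorem tendsto_lconv (α : MonoidAlgebra ℤ G) (hξ0 : Tendsto ξ cofinite (𝓝 0)) :
    Tendsto (lconv α ξ) cofinite (𝓝 0) := by
  have : Tendsto (fun u => ∑ g ∈ α.coeff.support, (α.coeff g : ℝ) * ξ (g⁻¹ * u)) cofinite
      (𝓝 (∑ g ∈ α.coeff.support, (α.coeff g : ℝ) * 0)) :=
    tendsto_finsetSum _ fun g _ =>
      (hξ0.comp (mul_right_injective g⁻¹).tendsto_cofinite).const_mul _
  simp only [mul_zero, Finset.sum_const_zero] at this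
  exact this

/-- A right inverse under convolution is also a left inverse. -/
theorem lconv_self_eq [DecidableEq G] (hf : IsSemiLopsided f) (hS : IsPointed (nonidSupport f))
    (hξ0 : Tendsto ξ cofinite (𝓝 0))
    (hξ : rconv ξ (fun g => (f.coeff g : ℝ)) = Set.indicator {1} (fun _ => (1 : ℝ))) (u : G) :
    lconv f ξ u = if u = 1 then 1 else 0 := by
  -- Right multiplication by f kills fξ − δ₁, because (fξ)f = f(ξf) = f; injectivity finishes.
  have key : ∀ u, lconv f ξ u - (if u = 1 then 1 else 0) = 0 := by
    refine eq_zero_of_rconv_eq_zero hf hS ?_ fun g => ?_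
    · have h1 : Tendsto (fun u : G => if u = 1 then (1 : ℝ) else 0) cofinite (𝓝 0) := by
        refine tendsto_const_nhds.congr' ?_
        filter_upwards [(Set.finite_singleton (1 : G)).compl_mem_cofinite] with u hu
        simp at hu
        simp [hu]
      simpa using (tendsto_lconv f hξ0).sub h1
    · rw [rconv_eq_sum]
      simp_rw [mul_sub, Finset.sum_sub_distrib, lconv, Finset.mul_sum]
      rw [Finset.sum_comm]
      have h1 : ∀ k, ∑ h ∈ f.coeff.support,
          (f.coeff h : ℝ) * ((f.coeff k : ℝ) * ξ (k⁻¹ * (g * h⁻¹))) =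
          f.coeff k * (if k = g then 1 else 0) := by
        intro k
        have h2 := congrFun hξ (k⁻¹ * g)
        rw [rconv_eq_sum] at h2
        simp_rw [mul_left_comm _ (f.coeff k : ℝ), ← Finset.mul_sum, ← mul_assoc k⁻¹, h2]
        simp [Set.indicator_apply, inv_mul_eq_one]
      simp_rw [h1, mul_inv_eq_one, eq_comm (a := g)]
      exact sub_self _
  exact sub_eq_zero.1 (key u)

/-- If `α` is not in the left ideal generated by `f`, then some value of `α ξ` is a nonintegral
multiple of `1 / f₁`. -/
theorem exists_lconv_mul_eq_intCast (hf : IsSemiLopsided f) (hS : IsPointed (nonidSupport f))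
    (hξ0 : Tendsto ξ cofinite (𝓝 0))
    (hξ : rconv ξ (fun g => (f.coeff g : ℝ)) = Set.indicator {1} (fun _ => (1 : ℝ)))
    {α : MonoidAlgebra ℤ G} (hα : α ∉ Ideal.span {f}) :
    ∃ (u : G) (m : ℤ), f.coeff 1 * lconv α ξ u = m ∧ ¬ f.coeff 1 ∣ m := by
  classical
  by_contra! hcon
  have hint : ∀ (u : G) (m : ℤ), f.coeff 1 * lconv α ξ u = m → ∃ n : ℤ, lconv α ξ u = n := by
    intro u m hm
    obtain ⟨n, rfl⟩ := hcon u m hm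
    refine ⟨n, mul_left_cancel₀ hf.pos.ne' (hm.trans (by push_cast; ring))⟩
  have hTfin : {u | (1 : ℝ) ≤ |lconv α ξ u|}.Finite := by
    have := ((tendsto_lconv α hξ0).abs).eventually (gt_mem_nhds (show |(0 : ℝ)| < 1 by simp))
    simpa [Filter.eventually_cofinite] using this
  -- γ copies αξ wherever it is an integer and is 0 elsewhere. Its support is finite since a nonzero
  -- integer has modulus at least 1 and αξ vanishes at infinity. Subtracting γf from α makes (α −
  -- γf)ξ vanish at every integral value of αξ.
  let γ : MonoidAlgebra ℤ G := .ofCoeff <| Finsupp.onFinset hTfin.toFinset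
    (fun u => if (∃ n : ℤ, lconv α ξ u = n) then ⌊lconv α ξ u⌋ else 0) (by
      intro u hu
      simp only [ne_eq, ite_eq_right_iff, not_forall] at hu
      obtain ⟨⟨n, hn⟩, hu⟩ := hu
      rw [hn, Int.floor_intCast] at hu
      rw [Set.Finite.mem_toFinset, Set.mem_ofPred_eq, hn]
      exact_mod_cast Int.one_le_abs hu)
  have hγ : ∀ u, (∃ n : ℤ, lconv α ξ u = n) → (γ.coeff u : ℝ) = lconv α ξ u := by
    intro u hu
    change ((if (∃ n : ℤ, lconv α ξ u = n) then ⌊lconv α ξ u⌋ else 0 : ℤ) : ℝ) = _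
    rw [if_pos hu]
    obtain ⟨n, hn⟩ := hu
    rw [hn, Int.floor_intCast]
  have hγ0 : ∀ u, (¬ ∃ n : ℤ, lconv α ξ u = n) → γ.coeff u = 0 := fun u hu => if_neg hu
  have hβ : ∀ u, lconv (α - γ * f) ξ u = lconv α ξ u - γ.coeff u := by
    intro u
    rw [lconv_sub, lconv_mul_of_lconv_eq (lconv_self_eq hf hS hξ0 hξ)]
  have hne : α - γ * f ≠ 0 := by
    intro h
    rw [sub_eq_zero.1 h] at hα
    exact hα (Ideal.mul_mem_left _ _ (Ideal.mem_span_singleton_self f))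
  obtain ⟨m, hm, hmin⟩ := hS.exists_minimal (T := {u | (α - γ * f).coeff u ≠ 0})
    ((α - γ * f).coeff.hasFiniteSupport) (by
      by_contra! h
      refine hne (MonoidAlgebra.ext (Finsupp.ext fun u => ?_))
      by_contra hu
      exact Set.eq_empty_iff_forall_notMem.1 h u hu)
  -- Since ξ is supported in P, only elements of the support below m contribute at m, and m is
  -- minimal.
  have hval : lconv (α - γ * f) ξ m = (α - γ * f).coeff m * ξ 1 := by
    rw [lconv, Finset.sum_eq_single m]
    · simp
    · intro b hb hbm
      rw [eq_zero_of_notMem_closure hf hS hξ0 hξ, mul_zero]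
      exact fun h => hbm (hmin b (Finsupp.mem_support_iff.1 hb) h)
    · intro h
      exact absurd (Finsupp.mem_support_iff.2 hm) h
  have h1 := coeff_one_mul_eq_one hf hS hξ0 hξ
  have hmul : f.coeff 1 * lconv (α - γ * f) ξ m = (α - γ * f).coeff m := by
    rw [hval, mul_left_comm, h1, mul_one]
  -- If (αξ)(m) were not an integer, then γ(m) = 0 and f₁ (αξ)(m) would be the integer (α − γf)_m,
  -- which the assumed divisibility excludes. So (αξ)(m) is an integer, and the coefficient at m is
  -- zero.
  have hex : ∃ n : ℤ, lconv α ξ m = n := by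
    by_contra hnot
    rw [hβ, hγ0 m hnot, Int.cast_zero, sub_zero] at hmul
    exact hnot (hint m _ hmul)
  rw [hβ, hγ m hex, sub_self, mul_zero] at hmul
  exact hm (by exact_mod_cast hmul.symm)

end Inverse

/-! ### Square-summable linear combinations of independent coordinates. -/

section Coordinates

variable {G : Type*} {ν : Measure ℝ} [IsProbabilityMeasure ν]

theorem memLp_coord (h2 : MemLp id 2 ν) (k : G) :
    MemLp (fun x : G → ℝ => x k) 2 (bernoulli G ν) :=
  h2.comp_measurePreserving (measurePreserving_eval_infinitePi (fun _ : G => ν) k)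

/-- The coordinate `x ↦ x(k)` as an element of `L²(ν^{⊗ G})`. -/
def coordLp (h2 : MemLp id 2 ν) (k : G) : Lp ℝ 2 (bernoulli G ν) := (memLp_coord h2 k).toLp _

theorem coordLp_ae (h2 : MemLp id 2 ν) (k : G) :
    coordLp h2 k =ᵐ[bernoulli G ν] fun x => x k := MemLp.coeFn_toLp _

theorem integral_coord {E : Type*} [NormedAddCommGroup E] [NormedSpace ℝ E] {φ : ℝ → E}
    (hφ : AEStronglyMeasurable φ ν) (i : G) :
    ∫ x, φ (x i) ∂(bernoulli G ν) = ∫ t, φ t ∂ν := by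
  have hev := measurePreserving_eval_infinitePi (fun _ : G => ν) i
  have h := integral_map (f := φ) hev.measurable.aemeasurable (by rwa [hev.map_eq])
  rw [hev.map_eq] at h
  exact h.symm

theorem inner_coordLp [DecidableEq G] (h2 : MemLp id 2 ν) (h0 : ∫ t, t ∂ν = 0) (i j : G) :
    inner ℝ (coordLp h2 i) (coordLp h2 j) = if i = j then ∫ t, t ^ 2 ∂ν else 0 := by
  have h1 : inner ℝ (coordLp h2 i) (coordLp h2 j) = ∫ x, x i * x j ∂(bernoulli G ν) := by
    rw [L2.inner_def]
    refine integral_congr_ae ?_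
    filter_upwards [coordLp_ae h2 i, coordLp_ae h2 j] with x hi hj
    rw [hi, hj, real_inner_comm]
    rfl
  rw [h1]
  split_ifs with hij
  · subst hij
    simp_rw [← sq]
    exact integral_coord (φ := fun t => t ^ 2) (by fun_prop) i
  · have hind := (ProbabilityTheory.iIndepFun_infinitePi (P := fun _ : G => ν)
      (X := fun _ t => t) (fun _ => measurable_id)).indepFun hij
    rw [hind.integral_fun_mul_eq_mul_integral (measurable_pi_apply i).aestronglyMeasurable
      (measurable_pi_apply j).aestronglyMeasurable]
    rw [integral_coord (φ := fun t => t) (by fun_prop) i, h0, zero_mul]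

/-- For a centered measure `ν` of finite positive variance, `η ↦ ∑_k η(k) x(k)` is a bounded map
from `ℓ²(G)` to `L²(ν^{⊗ G})`. -/
theorem exists_l2_sum (h2 : MemLp id 2 ν) (h0 : ∫ t, t ∂ν = 0) (hσ : ∫ t, t ^ 2 ∂ν ≠ 0) :
    ∃ Z : lp (fun _ : G => ℝ) 2 →L[ℝ] Lp ℝ 2 (bernoulli G ν),
      ∀ η, HasSum (fun k => η k • coordLp h2 k) (Z η) := by
  classical
  set σ := Real.sqrt (∫ t, t ^ 2 ∂ν)
  have hpos : 0 < ∫ t, t ^ 2 ∂ν := lt_of_le_of_ne (integral_nonneg fun t => sq_nonneg t) hσ.symm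
  have hσpos : 0 < σ := Real.sqrt_pos.2 hpos
  have hσ2 : σ * σ = ∫ t, t ^ 2 ∂ν := Real.mul_self_sqrt hpos.le
  -- Centered independent coordinates are orthogonal of norm σ, so the sum map is σ times an
  -- isometry; nonzero variance is needed for the normalisation.
  have hon : Orthonormal ℝ (fun k : G => σ⁻¹ • coordLp h2 k) := by
    rw [orthonormal_iff_ite]
    intro i j
    rw [real_inner_smul_left, real_inner_smul_right, inner_coordLp h2 h0, ← hσ2]
    split_ifs
    · field_simp
    · simp
  refine ⟨σ • hon.orthogonalFamily.linearIsometry.toContinuousLinearMap, fun η => ?_⟩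
  have := (hon.orthogonalFamily.hasSum_linearIsometry η).const_smul σ
  refine this.congr_fun fun k => ?_
  rw [LinearIsometry.toSpanSingleton_apply, smul_comm (η k), smul_smul σ, mul_inv_cancel₀ hσpos.ne',
    one_smul]

theorem sum_smul_coordLp_ae (h2 : MemLp id 2 ν) (η : G → ℝ) (s : Finset G) :
    (∑ k ∈ s, η k • coordLp h2 k : Lp ℝ 2 (bernoulli G ν)) =ᵐ[bernoulli G ν]
      fun x => ∑ k ∈ s, η k * x k := by
  refine (Lp.coeFn_finsetSum _ _).trans ?_
  have h3 : ∀ᵐ x ∂(bernoulli G ν), ∀ k ∈ s, (η k • coordLp h2 k : Lp ℝ 2 _) x = η k * x k := by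
    refine (Finset.eventually_all s).2 fun k _ => ?_
    filter_upwards [Lp.coeFn_smul (η k) (coordLp h2 k), coordLp_ae h2 k] with x h4 h5
    rw [h4, Pi.smul_apply, h5, smul_eq_mul]
  filter_upwards [h3] with x hx
  rw [Finset.sum_apply]
  exact Finset.sum_congr rfl hx

theorem l2_sum_eq_sum {h2 : MemLp id 2 ν}
    {Z : lp (fun _ : G => ℝ) 2 →L[ℝ] Lp ℝ 2 (bernoulli G ν)}
    (hZ : ∀ η, HasSum (fun k => η k • coordLp h2 k) (Z η))
    (η : lp (fun _ : G => ℝ) 2) {s : Finset G} (hs : ∀ k ∉ s, η k = 0) :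
    Z η =ᵐ[bernoulli G ν] fun x => ∑ k ∈ s, η k * x k := by
  have h1 : Z η = ∑ k ∈ s, η k • coordLp h2 k :=
    (hZ η).unique (hasSum_sum_of_ne_finset_zero fun k hk => by rw [hs k hk, zero_smul])
  rw [h1]
  exact sum_smul_coordLp_ae h2 _ s

end Coordinates

/-! ### Existence, uniqueness and equivariance of the ℓ²-convolution map. -/

section Convolution

variable {G : Type*} [Group G]

/-- The substitution k = gh⁻¹ turns (xη*)(g) into the pairing of x with the left translate of η by
g, which is why `convFun` is built from `translate g η`. -/
theorem rconv_inv_eq_sum (x : G → ℝ) (η : G → ℝ) (g : G) {s : Finset G}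
    (hs : ∀ k ∉ s, η (g⁻¹ * k) = 0) :
    rconv x (fun h => η h⁻¹) g = ∑ k ∈ s, η (g⁻¹ * k) * x k := by
  rw [rconv, ← finsum_comp_equiv ((Equiv.inv G).trans (Equiv.mulRight g)),
    finsum_eq_sum_of_support_subset (s := s)]
  · refine Finset.sum_congr rfl fun k _ => ?_
    simp [mul_comm]
  · intro k hk
    by_contra hks
    apply hk
    simp [hs k hks]

/-- The left translation on `ℓ²(G)`. -/
def translate (g : G) : lp (fun _ : G => ℝ) 2 →ₗᵢ[ℝ] lp (fun _ : G => ℝ) 2 where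
  toFun ξ := ⟨fun u => ξ (g⁻¹ * u), by
    have h := (memℓp_gen_iff (by simp)).1 (lp.memℓp ξ)
    exact memℓp_gen ((Equiv.mulLeft g⁻¹).summable_iff.2 h)⟩
  map_add' _ _ := rfl
  map_smul' _ _ := rfl
  norm_map' ξ := by
    rw [lp.norm_eq_tsum_rpow (by simp), lp.norm_eq_tsum_rpow (by simp)]
    congr 1
    exact (Equiv.mulLeft g⁻¹).tsum_eq (fun u => ‖ξ u‖ ^ (2 : ℝ≥0∞).toReal)

@[simp]
theorem translate_apply (g : G) (ξ : lp (fun _ : G => ℝ) 2) (u : G) :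
    translate g ξ u = ξ (g⁻¹ * u) := rfl

theorem measurePreserving_shift (κ : Measure ℝ) [IsProbabilityMeasure κ] (g : G) :
    MeasurePreserving (shift g) (bernoulli G κ) (bernoulli G κ) := by
  have h := Measure.infinitePi_map_piCongrLeft (fun _ : G => κ) (Equiv.mulLeft g)
  have h1 : ⇑(MeasurableEquiv.piCongrLeft (fun _ : G => ℝ) (Equiv.mulLeft g)) = shift g := by
    funext x u
    obtain ⟨v, rfl⟩ := (Equiv.mulLeft g).surjective u
    rw [MeasurableEquiv.coe_piCongrLeft, Equiv.piCongrLeft_apply_apply]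
    simp [shift]
  rw [h1] at h
  exact ⟨measurable_pi_lambda _ fun u => measurable_pi_apply _, h⟩

variable {ν : Measure ℝ} [IsProbabilityMeasure ν] {h2 : MemLp id 2 ν}
  {Z : lp (fun _ : G => ℝ) 2 →L[ℝ] Lp ℝ 2 (bernoulli G ν)}

/-- Composition with the shift by g is an isometry of L² taking the coordinate at k to the one at
g⁻¹k; apply it termwise to the series and reindex. -/
theorem l2_sum_translate_shift (hZ : ∀ η, HasSum (fun k => η k • coordLp h2 k) (Z η))
    (η : lp (fun _ : G => ℝ) 2) (g h : G) :
    (fun x => Z (translate h η) (shift g x)) =ᵐ[bernoulli G ν] Z (translate (g⁻¹ * h) η) := by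
  have hmp := measurePreserving_shift ν g
  set C := Lp.compMeasurePreservingₗᵢ (E := ℝ) (p := 2) ℝ (shift g) hmp
  have hC (k : G) : C (coordLp h2 k) = coordLp h2 (g⁻¹ * k) := by
    refine Lp.ext ?_
    refine (Lp.coeFn_compMeasurePreserving _ hmp).trans ?_
    filter_upwards [hmp.quasiMeasurePreserving.ae (coordLp_ae h2 k), coordLp_ae h2 (g⁻¹ * k)]
      with x h1 h3
    rw [Function.comp, h1, h3, shift]
  have h1 := (hZ (translate h η)).mapL C.toContinuousLinearMap
  have h3 := (Equiv.mulLeft g⁻¹).hasSum_iff.2 (hZ (translate (g⁻¹ * h) η))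
  have h4 : C (Z (translate h η)) = Z (translate (g⁻¹ * h) η) := by
    refine h1.unique (h3.congr_fun fun k => ?_)
    rw [map_smul]
    change translate h η k • C (coordLp h2 k) =
      translate (g⁻¹ * h) η (g⁻¹ * k) • coordLp h2 (g⁻¹ * k)
    rw [hC, translate_apply, translate_apply]
    congr 2
    group
  rw [← h4]
  exact (Lp.coeFn_compMeasurePreserving _ hmp).symm

/-- The random element `g ↦ ∑_k η(k) x(g k) mod ℤ` of `𝕋^G`. -/
def convFun (Z : lp (fun _ : G => ℝ) 2 →L[ℝ] Lp ℝ 2 (bernoulli G ν))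
    (η : lp (fun _ : G => ℝ) 2) (x : G → ℝ) (g : G) : UnitAddCircle :=
  (Z (translate g η) x : ℝ)

omit [IsProbabilityMeasure ν] in
theorem measurable_convFun (η : lp (fun _ : G => ℝ) 2) : Measurable (convFun Z η) :=
  measurable_pi_lambda _ fun _ =>
    (AddCircle.measurable_mk' (a := (1 : ℝ))).comp (Lp.stronglyMeasurable _).measurable

variable [Countable G]

/-- The `ℓ²`-convolution map. -/
def convMap (Z : lp (fun _ : G => ℝ) 2 →L[ℝ] Lp ℝ 2 (bernoulli G ν))
    (η : lp (fun _ : G => ℝ) 2) : (G → ℝ) →ₘ[bernoulli G ν] (G → UnitAddCircle) :=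
  AEEqFun.mk (convFun Z η) (measurable_convFun η).aestronglyMeasurable

omit [IsProbabilityMeasure ν] in
theorem convMap_ae (η : lp (fun _ : G => ℝ) 2) :
    convMap Z η =ᵐ[bernoulli G ν] convFun Z η := AEEqFun.coeFn_mk _ _

theorem convMap_of_finite (hZ : ∀ η, HasSum (fun k => η k • coordLp h2 k) (Z η))
    (η : lp (fun _ : G => ℝ) 2) (hη : (Function.support fun g => η g).Finite) :
    ∀ᵐ x ∂(bernoulli G ν), ∀ g : G,
      convMap Z η x g = ((rconv x (fun h => η h⁻¹) g : ℝ) : UnitAddCircle) := by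
  classical
  have hs : ∀ g : G, ∀ k ∉ hη.toFinset.image (g * ·), translate g η k = 0 := by
    intro g k hk
    by_contra h
    exact hk (Finset.mem_image.2 ⟨g⁻¹ * k, by simpa using h, by simp⟩)
  have h1 : ∀ᵐ x ∂(bernoulli G ν), ∀ g : G, Z (translate g η) x =
      ∑ k ∈ hη.toFinset.image (g * ·), η (g⁻¹ * k) * x k :=
    ae_all_iff.2 fun g => l2_sum_eq_sum hZ (translate g η) (hs g)
  filter_upwards [h1, convMap_ae η] with x h3 h4 g
  rw [h4, convFun, h3, rconv_inv_eq_sum x (fun k => η k) g (hs g)]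

theorem dist_coe_le (a b : ℝ) : dist (a : UnitAddCircle) (b : UnitAddCircle) ≤ dist a b := by
  rw [dist_eq_norm, dist_eq_norm, ← AddCircle.coe_sub]
  exact QuotientAddGroup.norm_mk_le_norm

-- An entourage of the product constrains finitely many coordinates. In each one, L² convergence
-- implies convergence in measure, and reduction mod ℤ is 1-Lipschitz.
omit [IsProbabilityMeasure ν] in
theorem tendsto_convMap (η : lp (fun _ : G => ℝ) 2) (V : Set ((G → UnitAddCircle) × _))
    (hV : V ∈ uniformity (G → UnitAddCircle)) :
    Tendsto (fun ζ => bernoulli G ν {x | (convMap Z ζ x, convMap Z η x) ∉ V}) (𝓝 η) (𝓝 0) := by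
  have hcongr : ∀ ζ, bernoulli G ν {x | (convMap Z ζ x, convMap Z η x) ∉ V} =
      bernoulli G ν {x | (convFun Z ζ x, convFun Z η x) ∉ V} := by
    intro ζ
    refine measure_congr ?_
    filter_upwards [convMap_ae (Z := Z) ζ, convMap_ae (Z := Z) η] with x h1 h3
    change ((convMap Z ζ x, convMap Z η x) ∉ V) = ((convFun Z ζ x, convFun Z η x) ∉ V)
    rw [h1, h3]
  simp_rw [hcongr]
  rw [Pi.uniformity] at hV
  refine Filter.iInf_sets_induct hV
    (p := fun V => Tendsto (fun ζ => bernoulli G ν {x | (convFun Z ζ x, convFun Z η x) ∉ V})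
      (𝓝 η) (𝓝 0)) (by simp) ?_
  intro g V₁ V₂ h1 h3
  obtain ⟨W, hW, hWV⟩ := h1
  obtain ⟨ε, hε, hεW⟩ := Metric.mem_uniformity_dist.1 hW
  have hm : Tendsto (fun ζ => bernoulli G ν
      {x | ε ≤ dist (Z (translate g ζ) x) (Z (translate g η) x)}) (𝓝 η) (𝓝 0) := by
    have hc : Tendsto (fun ζ => Z (translate g ζ)) (𝓝 η) (𝓝 (Z (translate g η))) :=
      (Z.continuous.comp (translate g).continuous).tendsto η
    exact tendstoInMeasure_iff_dist.1 (tendstoInMeasure_of_tendsto_Lp hc) ε hε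
  have hadd := hm.add h3
  rw [add_zero] at hadd
  refine tendsto_of_tendsto_of_tendsto_of_le_of_le tendsto_const_nhds hadd
    (fun _ => zero_le) fun ζ => ?_
  refine (measure_mono ?_).trans (measure_union_le _ _)
  intro x hx
  by_contra hcon
  simp only [Set.mem_union, Set.mem_ofPred_eq, not_or, not_le, not_not] at hcon
  exact hx ⟨hWV (hεW ((dist_coe_le _ _).trans_lt hcon.1)), hcon.2⟩

theorem isL2Convolution_convMap (hZ : ∀ η, HasSum (fun k => η k • coordLp h2 k) (Z η)) :
    IsL2Convolution ν (convMap Z) :=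
  ⟨fun η hη => convMap_of_finite hZ η hη, fun η V hV => tendsto_convMap η V hV⟩

omit [IsProbabilityMeasure ν] in
/-- The `ℓ²`-convolution map is unique. -/
theorem IsL2Convolution.unique
    {Θ Θ' : lp (fun _ : G => ℝ) 2 → ((G → ℝ) →ₘ[bernoulli G ν] (G → UnitAddCircle))}
    (hΘ : IsL2Convolution ν Θ) (hΘ' : IsL2Convolution ν Θ') : Θ' = Θ := by
  classical
  funext ξ
  refine AEEqFun.ext ?_
  have key : ∀ V ∈ uniformity (G → UnitAddCircle), ∀ᵐ x ∂(bernoulli G ν),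
      (Θ' ξ x, Θ ξ x) ∈ V := by
    intro V hV
    obtain ⟨W, hW, hWsymm, hWV⟩ := comp_symm_mem_uniformity_sets hV
    -- Both maps agree almost everywhere on the finite truncations of ξ, which converge to ξ in ℓ².
    let a : Finset G → lp (fun _ : G => ℝ) 2 := fun s => ∑ k ∈ s, lp.single 2 k (ξ k)
    have ha : Tendsto a atTop (𝓝 ξ) := lp.hasSum_single (by simp) ξ
    have hafin : ∀ s, (Function.support fun g => a s g).Finite := by
      intro s
      refine s.finite_toSet.subset fun g hg => ?_
      by_contra hgs
      refine hg ?_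
      simp only [a, lp.coeFn_sum, Finset.sum_apply]
      refine Finset.sum_eq_zero fun k hk => ?_
      rw [lp.single_apply_ne]
      rintro rfl
      exact hgs hk
    have h1 := ((hΘ'.2 ξ W hW).comp ha).add ((hΘ.2 ξ W hW).comp ha)
    rw [add_zero] at h1
    have h3 : ∀ s, bernoulli G ν {x | (Θ' ξ x, Θ ξ x) ∉ V} ≤
        bernoulli G ν {x | (Θ' (a s) x, Θ' ξ x) ∉ W} +
          bernoulli G ν {x | (Θ (a s) x, Θ ξ x) ∉ W} := by
      intro s
      refine le_trans (measure_mono_ae ?_) (measure_union_le _ _)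
      filter_upwards [hΘ.1 (a s) (hafin s), hΘ'.1 (a s) (hafin s)] with x h4 h5 hx
      by_contra hcon
      have hcon' : (Θ' (a s) x, Θ' ξ x) ∈ W ∧ (Θ (a s) x, Θ ξ x) ∈ W := by
        by_contra h
        exact hcon (not_and_or.1 h)
      have heq : Θ' (a s) x = Θ (a s) x := funext fun g => (h5 g).trans (h4 g).symm
      rw [heq] at hcon'
      exact hx (hWV ⟨_, hWsymm.symm _ _ hcon'.1, hcon'.2⟩)
    exact le_antisymm (ge_of_tendsto' h1 h3) zero_le
  -- A countable basis of entourages lets one null set serve for all of them.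
  obtain ⟨U, hU⟩ := (uniformity (G → UnitAddCircle)).exists_antitone_basis
  filter_upwards [ae_all_iff.2 fun n => key (U n) (hU.1.mem_of_mem trivial)] with x hx
  refine eq_of_uniformity fun {V} hV => ?_
  obtain ⟨n, -, hn⟩ := hU.1.mem_iff.1 hV
  exact hn (hx n)

theorem convMap_shift (hZ : ∀ η, HasSum (fun k => η k • coordLp h2 k) (Z η))
    (η : lp (fun _ : G => ℝ) 2) (g : G) : ∀ᵐ x ∂(bernoulli G ν),
      convMap Z η (shift g x) = shift g (convMap Z η x) := by
  have h1 : ∀ᵐ x ∂(bernoulli G ν), ∀ h, Z (translate h η) (shift g x) =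
      Z (translate (g⁻¹ * h) η) x := ae_all_iff.2 fun h => l2_sum_translate_shift hZ η g h
  filter_upwards [h1, convMap_ae (Z := Z) η,
    (measurePreserving_shift ν g).quasiMeasurePreserving.ae (convMap_ae (Z := Z) η)] with x h3 h4 h5
  rw [h4, h5]
  funext h
  simp only [convFun, shift] at h3 ⊢
  rw [h3]

end Convolution

/-! ### The measure ν and the zeros of its Fourier transform. -/

section DifferenceLaw

/-- The law of `i - j` for independent uniformly distributed `i, j ∈ {0, …, N - 1}`. -/
def diffLaw (N : ℕ) : Measure ℝ :=
  ((N : ℝ≥0∞) * N)⁻¹ • ∑ i ∈ Finset.range N, ∑ j ∈ Finset.range N, Measure.dirac ((i : ℝ) - j)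

theorem isProbabilityMeasure_diffLaw {N : ℕ} (hN : N ≠ 0) : IsProbabilityMeasure (diffLaw N) := by
  constructor
  simp only [diffLaw, Measure.smul_apply, Measure.finsetSum_apply, measure_univ, Finset.sum_const,
    Finset.card_range, smul_eq_mul, nsmul_eq_mul, mul_one]
  refine ENNReal.inv_mul_cancel ?_ ?_
  · simpa using hN
  · exact ENNReal.mul_ne_top (by simp) (by simp)

theorem ae_diffLaw {N : ℕ} {p : ℝ → Prop} (h : ∀ i < N, ∀ j < N, p ((i : ℝ) - j)) :
    ∀ᵐ t ∂(diffLaw N), p t := by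
  refine Measure.ae_smul_measure ?_ _
  rw [ae_finsetSum_measure_iff]
  intro i hi
  rw [ae_finsetSum_measure_iff]
  intro j hj
  rw [ae_dirac_eq]
  exact h i (Finset.mem_range.1 hi) j (Finset.mem_range.1 hj)

theorem integral_diffLaw {E : Type*} [NormedAddCommGroup E] [NormedSpace ℝ E] [CompleteSpace E]
    (N : ℕ) (φ : ℝ → E) :
    ∫ t, φ t ∂(diffLaw N) =
      ((N : ℝ) * N)⁻¹ • ∑ i ∈ Finset.range N, ∑ j ∈ Finset.range N, φ ((i : ℝ) - j) := by
  have hint (i j : ℕ) : Integrable φ (Measure.dirac ((i : ℝ) - j)) :=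
    integrable_dirac enorm_lt_top
  rw [diffLaw, integral_smul_measure, integral_finsetSum_measure fun i _ =>
    integrable_finsetSum_measure.2 fun j _ => hint i j]
  congr 1
  · simp
  · refine Finset.sum_congr rfl fun i _ => ?_
    rw [integral_finsetSum_measure fun j _ => hint i j]
    exact Finset.sum_congr rfl fun j _ => integral_dirac _ _

theorem exists_finset_diffLaw (N : ℕ) :
    ∃ F : Finset ℤ, diffLaw N ((fun n : ℤ => (n : ℝ)) '' (F : Set ℤ))ᶜ = 0 := by
  classical
  refine ⟨(Finset.range N ×ˢ Finset.range N).image fun p => (p.1 : ℤ) - p.2, ?_⟩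
  rw [← mem_ae_iff]
  refine ae_diffLaw fun i hi j hj => ⟨(i : ℤ) - j, ?_, by push_cast; rfl⟩
  exact Finset.mem_coe.2 (Finset.mem_image.2 ⟨(i, j), by simp [hi, hj], rfl⟩)

theorem ae_diffLaw_int (N : ℕ) : ∀ᵐ t : ℝ ∂(diffLaw N), ∃ n : ℤ, t = n :=
  ae_diffLaw (p := fun t => ∃ n : ℤ, t = n) fun i _ j _ => ⟨(i : ℤ) - j, by push_cast; rfl⟩

theorem memLp_diffLaw {N : ℕ} (hN : N ≠ 0) : MemLp id 2 (diffLaw N) := by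
  have := isProbabilityMeasure_diffLaw hN
  refine MemLp.of_bound (by fun_prop) N (ae_diffLaw fun i hi j hj => ?_)
  have hi' : (i : ℝ) < N := by exact_mod_cast hi
  have hj' : (j : ℝ) < N := by exact_mod_cast hj
  rw [id, Real.norm_eq_abs, abs_le]
  constructor <;> linarith [Nat.cast_nonneg (α := ℝ) i, Nat.cast_nonneg (α := ℝ) j]

theorem integral_id_diffLaw (N : ℕ) : ∫ t, t ∂(diffLaw N) = 0 := by
  rw [integral_diffLaw N fun t => t]
  simp [Finset.sum_sub_distrib, ← Finset.mul_sum]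

theorem integral_sq_diffLaw_ne_zero {N : ℕ} (hN : 2 ≤ N) : ∫ t, t ^ 2 ∂(diffLaw N) ≠ 0 := by
  rw [integral_diffLaw N fun t => t ^ 2]
  have hpos : 0 < ∑ i ∈ Finset.range N, ∑ j ∈ Finset.range N, ((i : ℝ) - j) ^ 2 := by
    refine Finset.sum_pos' (fun i _ => Finset.sum_nonneg fun j _ => sq_nonneg _)
      ⟨1, Finset.mem_range.2 hN, Finset.sum_pos' (fun j _ => sq_nonneg _)
        ⟨0, Finset.mem_range.2 (by lia), by simp⟩⟩
  have hN' : (0 : ℝ) < N := by exact_mod_cast (by lia : 0 < N)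
  exact (smul_pos (inv_pos.2 (mul_pos hN' hN')) hpos).ne'

/-- The Fourier transform of `diffLaw N` vanishes at the nonintegral multiples of `1 / N`. -/
theorem integral_toCircle_diffLaw {N : ℕ} {c : ℝ} {m : ℤ} (hc : N * c = m)
    (hc' : (c : UnitAddCircle) ≠ 0) :
    ∫ t, (AddCircle.toCircle ((c * t : ℝ) : UnitAddCircle) : ℂ) ∂(diffLaw N) = 0 := by
  rw [integral_diffLaw N fun t => (AddCircle.toCircle ((c * t : ℝ) : UnitAddCircle) : ℂ)]
  set z : ℂ := (AddCircle.toCircle (c : UnitAddCircle) : ℂ) with hzdef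
  have hz : z ≠ 1 := by
    intro h
    have h1 : AddCircle.toCircle (c : UnitAddCircle) =
        AddCircle.toCircle (0 : UnitAddCircle) := by
      rw [AddCircle.toCircle_zero]
      exact Circle.ext h
    exact hc' (AddCircle.injective_toCircle one_ne_zero h1)
  have hterm (i j : ℕ) : (AddCircle.toCircle ((c * (i - j) : ℝ) : UnitAddCircle) : ℂ) =
      z ^ i * (AddCircle.toCircle (-(j • (c : UnitAddCircle)))) := by
    have h1 : ((c * (i - j) : ℝ) : UnitAddCircle) =
        i • (c : UnitAddCircle) + -(j • (c : UnitAddCircle)) := by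
      rw [← AddCircle.coe_nsmul, ← AddCircle.coe_nsmul, ← AddCircle.coe_neg, ← AddCircle.coe_add]
      congr 1
      simp only [nsmul_eq_mul]
      ring
    rw [h1, AddCircle.toCircle_add, AddCircle.toCircle_nsmul]
    simp [z]
  have hzN : z ^ N = 1 := by
    have h1 : N • (c : UnitAddCircle) = 0 := by
      rw [← AddCircle.coe_nsmul, nsmul_eq_mul, hc]
      exact (AddCircle.coe_eq_zero_iff 1).2 ⟨m, by simp⟩
    have h3 := AddCircle.toCircle_nsmul (c : UnitAddCircle) N
    rw [h1, AddCircle.toCircle_zero] at h3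
    have h4 := congrArg (fun w : Circle => (w : ℂ)) h3
    simpa [z] using h4.symm
  -- The double sum factors, and one factor is a full geometric sum over powers of a nontrivial N-th
  -- root of unity.
  simp_rw [hterm, ← Finset.sum_mul_sum, geom_sum_eq hz, hzN]
  simp

end DifferenceLaw

/-! ### Vanishing of Fourier coefficients through a single coordinate. -/

section FourierCoefficients

variable {G : Type*} {ν : Measure ℝ} [IsProbabilityMeasure ν]

theorem continuous_toCircle_coe :
    Continuous fun t : ℝ => (AddCircle.toCircle (t : UnitAddCircle) : ℂ) :=
  continuous_subtype_val.comp (AddCircle.continuous_toCircle.comp (AddCircle.continuous_mk' 1))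

theorem integral_toCircle_sum_eq_zero [DecidableEq G] (β : G → ℝ) {u : G}
    (hu : ∫ t, (AddCircle.toCircle ((β u * t : ℝ) : UnitAddCircle) : ℂ) ∂ν = 0)
    {s : Finset G} (hs : u ∈ s) :
    ∫ x, (AddCircle.toCircle ((∑ k ∈ s, β k * x k : ℝ) : UnitAddCircle) : ℂ)
      ∂(bernoulli G ν) = 0 := by
  have hmeas (k : G) : Measurable fun t : ℝ => β k * t := measurable_id.const_mul _
  have hind := ProbabilityTheory.iIndepFun_infinitePi (P := fun _ : G => ν)
    (X := fun k t => β k * t) hmeas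
  have hind2 := hind.indepFun_finsetSum_of_notMem
    (fun k => (hmeas k).comp (measurable_pi_apply k)) (Finset.notMem_erase u s)
  have he := continuous_toCircle_coe.measurable
  have hind3 := hind2.comp he he
  have hsplit (x : G → ℝ) :
      (AddCircle.toCircle ((∑ k ∈ s, β k * x k : ℝ) : UnitAddCircle) : ℂ) =
      (AddCircle.toCircle (((∑ k ∈ s.erase u, fun x : G → ℝ => β k * x k) x : ℝ) :
        UnitAddCircle) : ℂ) *
      (AddCircle.toCircle ((β u * x u : ℝ) : UnitAddCircle) : ℂ) := by
    rw [← Finset.sum_erase_add _ _ hs, AddCircle.coe_add, AddCircle.toCircle_add, Finset.sum_apply]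
    simp
  simp_rw [hsplit]
  have hsum : Measurable (∑ k ∈ s.erase u, fun x : G → ℝ => β k * x k) := by
    rw [Finset.sum_fn]
    fun_prop
  refine (hind3.integral_fun_mul_eq_mul_integral (he.comp hsum).aestronglyMeasurable
    (he.comp ((hmeas u).comp (measurable_pi_apply u))).aestronglyMeasurable).trans ?_
  have h1 := integral_coord (G := G) (ν := ν)
    (φ := fun t => (AddCircle.toCircle ((β u * t : ℝ) : UnitAddCircle) : ℂ))
    (he.comp (hmeas u)).aestronglyMeasurable u
  rw [hu] at h1
  simp only [Function.comp_def]
  rw [h1, mul_zero]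

/-- Finite partial sums containing u have zero coefficient by independence. Along a subsequence they
converge almost everywhere, and dominated convergence passes to the limit. -/
theorem integral_toCircle_l2_sum_eq_zero [Countable G] {h2 : MemLp id 2 ν}
    {Z : lp (fun _ : G => ℝ) 2 →L[ℝ] Lp ℝ 2 (bernoulli G ν)}
    (hZ : ∀ η, HasSum (fun k => η k • coordLp h2 k) (Z η))
    (β : lp (fun _ : G => ℝ) 2) {u : G}
    (hu : ∫ t, (AddCircle.toCircle ((β u * t : ℝ) : UnitAddCircle) : ℂ) ∂ν = 0) :
    ∫ x, (AddCircle.toCircle ((Z β x : ℝ) : UnitAddCircle) : ℂ) ∂(bernoulli G ν) = 0 := by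
  classical
  obtain ⟨ns, hns, hlim⟩ := (tendstoInMeasure_of_tendsto_Lp (hZ β)).exists_seq_tendsto_ae'
  have hconv : Tendsto (fun n => ∫ x, (AddCircle.toCircle
      ((∑ k ∈ ns n, β k * x k : ℝ) : UnitAddCircle) : ℂ) ∂(bernoulli G ν)) atTop
      (𝓝 (∫ x, (AddCircle.toCircle ((Z β x : ℝ) : UnitAddCircle) : ℂ) ∂(bernoulli G ν))) := by
    refine tendsto_integral_of_dominated_convergence (fun _ => 1) (fun n => ?_)
      (integrable_const 1) (fun n => ?_) ?_
    · exact (continuous_toCircle_coe.measurable.comp (by fun_prop)).aestronglyMeasurable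
    · exact Eventually.of_forall fun x => (Circle.norm_coe _).le
    · filter_upwards [hlim, ae_all_iff.2 fun n => sum_smul_coordLp_ae h2 β (ns n)] with x h1 h3
      simp_rw [h3] at h1
      exact (continuous_toCircle_coe.tendsto _).comp h1
  refine tendsto_nhds_unique hconv (tendsto_const_nhds.congr' ?_)
  filter_upwards [hns.eventually (eventually_ge_atTop {u})] with n hn
  exact (integral_toCircle_sum_eq_zero (fun k => β k) hu (Finset.singleton_subset_iff.1 hn)).symm

end FourierCoefficients

/-! ### Characters of 𝕋^G determine finite measures. -/

section Characters

variable {G : Type*} [Group G]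

omit [Group G] in
theorem continuous_pairing (α : MonoidAlgebra ℤ G) :
    Continuous fun θ : G → UnitAddCircle => pairing θ α := by
  unfold pairing
  fun_prop

/-- The character of `𝕋^G` defined by `α ∈ ℤ(G)`. -/
def character (α : MonoidAlgebra ℤ G) : BoundedContinuousFunction (G → UnitAddCircle) ℂ :=
  .mkOfCompact ⟨fun θ => (AddCircle.toCircle (pairing θ α) : ℂ),
    continuous_subtype_val.comp (AddCircle.continuous_toCircle.comp (continuous_pairing α))⟩

omit [Group G] in
theorem character_apply (α : MonoidAlgebra ℤ G) (θ : G → UnitAddCircle) :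
    character α θ = (AddCircle.toCircle (pairing θ α) : ℂ) := rfl

theorem pairing_add (θ : G → UnitAddCircle) (α β : MonoidAlgebra ℤ G) :
    pairing θ (α + β) = pairing θ α + pairing θ β := map_add (pairingHom θ) α β

theorem pairing_neg (θ : G → UnitAddCircle) (α : MonoidAlgebra ℤ G) :
    pairing θ (-α) = -pairing θ α := map_neg (pairingHom θ) α

omit [Group G] in
theorem add_pairing (θ θ' : G → UnitAddCircle) (α : MonoidAlgebra ℤ G) :
    pairing (θ + θ') α = pairing θ α + pairing θ' α := by
  simp [pairing, smul_add, Finset.sum_add_distrib]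

/-- The algebra map from the group algebra of the dual of `𝕋^G` onto trigonometric polynomials. -/
def characterAlgHom (G : Type*) [Group G] :
    AddMonoidAlgebra ℂ (MonoidAlgebra ℤ G) →ₐ[ℂ]
      BoundedContinuousFunction (G → UnitAddCircle) ℂ :=
  AddMonoidAlgebra.lift ℂ _ _
    { toFun := fun α => character α.toAdd
      map_one' := by
        ext θ
        simp [character_apply, pairing]
      map_mul' := fun α β => by
        ext θ
        simp [character_apply, pairing_add, AddCircle.toCircle_add] }

theorem characterAlgHom_single (α : MonoidAlgebra ℤ G) (c : ℂ) :
    characterAlgHom G (.single α c) = c • character α := by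
  rw [characterAlgHom, AddMonoidAlgebra.lift_single]
  rfl

theorem star_character (α : MonoidAlgebra ℤ G) : star (character α) = character (-α) := by
  ext θ
  rw [character_apply, pairing_neg, AddCircle.toCircle_neg, Circle.coe_inv_eq_conj]
  rfl

/-- The star algebra of trigonometric polynomials on `𝕋^G`. -/
def trigPolynomials (G : Type*) [Group G] :
    StarSubalgebra ℂ (BoundedContinuousFunction (G → UnitAddCircle) ℂ) where
  toSubalgebra := (characterAlgHom G).range
  star_mem' := by
    rintro _ ⟨y, rfl⟩
    change star (characterAlgHom G y) ∈ (characterAlgHom G).range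
    induction y using AddMonoidAlgebra.induction_linear with
    | zero => rw [map_zero, star_zero]; exact zero_mem _
    | add x y hx hy => rw [map_add, star_add]; exact add_mem hx hy
    | single α c =>
      rw [characterAlgHom_single, star_smul, star_character, ← characterAlgHom_single]
      exact AlgHom.mem_range_self _ _

/-- Finite measures on `𝕋^G` are determined by their Fourier coefficients. -/
theorem ext_of_integral_character_eq [Countable G] {P P' : Measure (G → UnitAddCircle)}
    [IsFiniteMeasure P] [IsFiniteMeasure P']
    (h : ∀ α : MonoidAlgebra ℤ G, ∫ θ, character α θ ∂P = ∫ θ, character α θ ∂P') : P = P' := by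
  refine ext_of_forall_mem_subalgebra_integral_eq_of_polish (𝕜 := ℂ) (A := trigPolynomials G) ?_ ?_
  · intro θ θ' hne
    obtain ⟨g, hg⟩ := Function.ne_iff.1 hne
    refine ⟨character (.single g 1), ⟨_, ⟨character (.single g 1),
      ⟨.single (.single g 1) 1, ?_⟩, rfl⟩, rfl⟩, ?_⟩
    · exact (characterAlgHom_single _ _).trans (one_smul _ _)
    · intro heq
      have h1 (θ : G → UnitAddCircle) : pairing θ (.single g 1) = θ g := by
        have := pairingHom_single θ g 1
        rwa [one_smul] at this
      rw [character_apply, character_apply, h1, h1] at heq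
      exact hg (AddCircle.injective_toCircle one_ne_zero (Circle.ext heq))
  · rintro _ ⟨y, rfl⟩
    change ∫ θ, characterAlgHom G y θ ∂P = ∫ θ, characterAlgHom G y θ ∂P'
    induction y using AddMonoidAlgebra.induction_linear with
    | zero => simp
    | add x y hx hy =>
      rw [map_add]
      simp only [BoundedContinuousFunction.coe_add, Pi.add_apply]
      rw [integral_add (BoundedContinuousFunction.integrable _ _)
        (BoundedContinuousFunction.integrable _ _), hx, hy,
        integral_add (BoundedContinuousFunction.integrable _ _)
        (BoundedContinuousFunction.integrable _ _)]
    | single α c =>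
      rw [characterAlgHom_single]
      simp only [BoundedContinuousFunction.coe_smul]
      rw [integral_smul, integral_smul, h]

end Characters

/-! ### Pairing the convolution map with group ring elements. -/

section LeftMultiplication

variable {G : Type*} [Group G]

/-- The product `α ξ ∈ ℓ²(G)` of an element of the group ring and an element of `ℓ²(G)`. -/
def leftMul (α : MonoidAlgebra ℤ G) (ξ : lp (fun _ : G => ℝ) 2) : lp (fun _ : G => ℝ) 2 :=
  ∑ g ∈ α.coeff.support, (α.coeff g : ℝ) • translate g ξ

theorem leftMul_apply (α : MonoidAlgebra ℤ G) (ξ : lp (fun _ : G => ℝ) 2) (u : G) :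
    leftMul α ξ u = lconv α (fun g => ξ g) u := by
  rw [leftMul, lp.coeFn_sum, Finset.sum_apply]
  rfl

omit [Group G] in
theorem tendsto_lp_cofinite (ξ : lp (fun _ : G => ℝ) 2) :
    Tendsto (fun g => ξ g) cofinite (𝓝 0) := by
  have h := ((memℓp_gen_iff (by simp)).1 (lp.memℓp ξ)).tendsto_cofinite_zero
  simp only [ENNReal.toReal_ofNat, Real.rpow_ofNat, Real.norm_eq_abs, sq_abs] at h
  have h1 := (Real.continuous_sqrt.tendsto 0).comp h
  simp only [Function.comp_def, Real.sqrt_sq_eq_abs, Real.sqrt_zero] at h1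
  exact (tendsto_zero_iff_abs_tendsto_zero _).2 h1

variable {ν : Measure ℝ} [IsProbabilityMeasure ν]
  {Z : lp (fun _ : G => ℝ) 2 →L[ℝ] Lp ℝ 2 (bernoulli G ν)}

omit [IsProbabilityMeasure ν] in
theorem pairing_convFun_ae (α : MonoidAlgebra ℤ G) (ξ : lp (fun _ : G => ℝ) 2) :
    ∀ᵐ x ∂(bernoulli G ν),
      pairing (convFun Z ξ x) α = ((Z (leftMul α ξ) x : ℝ) : UnitAddCircle) := by
  have h1 : Z (leftMul α ξ) = ∑ g ∈ α.coeff.support, (α.coeff g : ℝ) • Z (translate g ξ) := by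
    simp [leftMul, map_sum]
  have h3 : ∀ᵐ x ∂(bernoulli G ν), ∀ g ∈ α.coeff.support,
      ((α.coeff g : ℝ) • Z (translate g ξ) : Lp ℝ 2 _) x = α.coeff g • Z (translate g ξ) x := by
    refine (Finset.eventually_all _).2 fun g _ => ?_
    filter_upwards [Lp.coeFn_smul (α.coeff g : ℝ) (Z (translate g ξ))] with x hx
    rw [hx, Pi.smul_apply, smul_eq_mul, zsmul_eq_mul]
  rw [h1]
  filter_upwards [h3, Lp.coeFn_finsetSum α.coeff.support
    fun g => (α.coeff g : ℝ) • Z (translate g ξ)] with x h4 h5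
  rw [h5, Finset.sum_apply, Finset.sum_congr rfl h4, pairing]
  simp only [convFun, ← AddCircle.coe_zsmul]
  exact (map_sum (QuotientAddGroup.mk' (AddSubgroup.zmultiples (1 : ℝ))) _ _).symm

end LeftMultiplication

/-! ### Haar measure on X_f and the passage to a factor map. -/

section Annihilator

variable {G : Type*} [Group G]

/-- Reduces membership to one condition per g ∈ G, which can be verified almost surely one g at a
time when G is countable. -/
theorem mem_X_of_forall_single {f : MonoidAlgebra ℤ G} {θ : G → UnitAddCircle}
    (h : ∀ g, pairing θ (MonoidAlgebra.single g 1 * f) = 0) : θ ∈ X f := by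
  intro α hα
  obtain ⟨γ, rfl⟩ := Ideal.mem_span_singleton'.1 hα
  have key : (pairingHom θ).comp (AddMonoidHom.mulRight f) = 0 := by
    refine MonoidAlgebra.addMonoidHom_ext fun g n => ?_
    have h1 : (MonoidAlgebra.single g n : MonoidAlgebra ℤ G) =
        n • MonoidAlgebra.single g 1 := by simp
    rw [h1, map_zsmul]
    change n • pairing θ (MonoidAlgebra.single g 1 * f) = 0
    rw [h, smul_zero]
  exact DFunLike.congr_fun key γ

variable [Countable G]

instance isAddHaarMeasure_haarX (f : MonoidAlgebra ℤ G) : (haarX f).IsAddHaarMeasure := by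
  unfold haarX
  infer_instance

instance isProbabilityMeasure_haarX (f : MonoidAlgebra ℤ G) : IsProbabilityMeasure (haarX f) :=
  ⟨Measure.addHaarMeasure_self (K₀ := (⊤ : TopologicalSpace.PositiveCompacts (X f)))⟩

theorem measurableSet_X (f : MonoidAlgebra ℤ G) :
    MeasurableSet ((X f : AddSubgroup (G → UnitAddCircle)) : Set (G → UnitAddCircle)) :=
  (isClosed_X f).measurableSet

/-- The Fourier coefficients of Haar measure vanish at characters nontrivial on `X_f`. -/
theorem integral_character_haarX_eq_zero {f α : MonoidAlgebra ℤ G} {θ₀ : G → UnitAddCircle}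
    (hθ₀ : θ₀ ∈ X f) (hne : character α θ₀ ≠ 1) :
    ∫ θ : X f, character α θ.1 ∂(haarX f) = 0 := by
  -- Translation by θ₀ preserves the integral and also multiplies it by a number different from 1.
  have h := integral_add_left_eq_self (μ := haarX f) (fun θ : X f => character α θ.1) ⟨θ₀, hθ₀⟩
  have hmul (θ : X f) : character α ((⟨θ₀, hθ₀⟩ : X f) + θ).1 =
      character α θ₀ * character α θ.1 := by
    change character α (θ₀ + θ.1) = _
    rw [character_apply, add_pairing, AddCircle.toCircle_add]
    rfl
  simp_rw [hmul, integral_const_mul] at h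
  have h1 : (character α θ₀ - 1) * ∫ θ : X f, character α θ.1 ∂(haarX f) = 0 := by
    rw [sub_mul, h, one_mul, sub_self]
  exact (mul_eq_zero.1 h1).resolve_left (sub_ne_zero.2 hne)

omit [Countable G] in
theorem character_eq_one {f α : MonoidAlgebra ℤ G} (hα : α ∈ Ideal.span {f})
    {θ : G → UnitAddCircle} (hθ : θ ∈ X f) : character α θ = 1 := by
  rw [character_apply, hθ α hα]
  simp

/-- A probability measure carried by `X_f` whose Fourier coefficients vanish outside `ℤ(G) f` is
the Haar measure. -/
theorem eq_map_haarX {f : MonoidAlgebra ℤ G} {P : Measure (G → UnitAddCircle)}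
    [IsProbabilityMeasure P] (hX : ∀ᵐ θ ∂P, θ ∈ X f)
    (h : ∀ α ∉ Ideal.span {f}, ∫ θ, character α θ ∂P = 0) :
    P = Measure.map Subtype.val (haarX f) := by
  have hval : AEMeasurable (Subtype.val : X f → G → UnitAddCircle) (haarX f) :=
    measurable_subtype_coe.aemeasurable
  have := Measure.isProbabilityMeasure_map hval
  refine ext_of_integral_character_eq fun α => ?_
  rw [integral_map hval (character α).continuous.aestronglyMeasurable]
  by_cases hα : α ∈ Ideal.span {f}
  · have h1 : ∫ θ, character α θ ∂P = ∫ _, (1 : ℂ) ∂P :=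
      integral_congr_ae (hX.mono fun θ hθ => character_eq_one hα hθ)
    have h3 : ∫ θ : X f, character α θ.1 ∂(haarX f) = ∫ _, (1 : ℂ) ∂(haarX f) :=
      integral_congr_ae (Eventually.of_forall fun θ => character_eq_one hα θ.2)
    rw [h1, h3]
    simp
  · rw [h α hα]
    -- P itself supplies the point, without appeal to duality: were the character 1 on X_f, its
    -- integral against P would be 1, not 0.
    have hex : ∃ θ₀ ∈ X f, character α θ₀ ≠ 1 := by
      by_contra! hcon
      have h1 : ∫ θ, character α θ ∂P = ∫ _, (1 : ℂ) ∂P := integral_congr_ae (hX.mono hcon)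
      rw [h α hα] at h1
      simp at h1
    obtain ⟨θ₀, hθ₀, hne⟩ := hex
    exact (integral_character_haarX_eq_zero hθ₀ hne).symm

/-- An equivariant measurable map onto `X_f ⊆ 𝕋^G` with the Haar measure as its law yields a
factor map from the Bernoulli shift. -/
theorem isFactorOfBernoulli_haarX {f : MonoidAlgebra ℤ G} {ν : Measure ℝ} [IsProbabilityMeasure ν]
    {Φ : (G → ℝ) → (G → UnitAddCircle)} (hΦ : AEMeasurable Φ (bernoulli G ν))
    (hequiv : ∀ g : G, ∀ᵐ x ∂(bernoulli G ν), Φ (shift g x) = shift g (Φ x))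
    (hmap : Measure.map Φ (bernoulli G ν) = Measure.map Subtype.val (haarX f)) :
    IsFactorOfBernoulli G (haarX f) := by
  classical
  have hemb := MeasurableEmbedding.subtype_coe (measurableSet_X f)
  have hmk := hΦ.ae_eq_mk
  set Ψ := hΦ.mk Φ
  have hΨ : Measurable Ψ := hΦ.measurable_mk
  have hX : ∀ᵐ x ∂(bernoulli G ν), Ψ x ∈ X f := by
    refine ae_of_ae_map (p := fun θ => θ ∈ X f) hΨ.aemeasurable ?_
    rw [← Measure.map_congr hmk, hmap]
    exact (ae_map_iff hemb.measurable.aemeasurable (measurableSet_X f)).2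
      (Eventually.of_forall fun θ => θ.2)
  -- The value 0 is used only on the null set where the measurable version leaves X_f.
  let φ : (G → ℝ) → X f := fun x => if h : Ψ x ∈ X f then ⟨Ψ x, h⟩ else 0
  have hφ : Measurable φ :=
    Measurable.dite (s := Ψ ⁻¹' (X f)) (f := fun x => (⟨Ψ x.1, x.2⟩ : X f)) (g := fun _ => 0)
      (hΨ.comp measurable_subtype_coe).subtype_mk measurable_const (hΨ (measurableSet_X f))
  have hφΨ : ∀ᵐ x ∂(bernoulli G ν), (φ x).1 = Φ x := by
    filter_upwards [hX, hmk] with x hx h1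
    rw [h1]
    simp only [φ, dif_pos hx]
  refine ⟨ℝ, inferInstance, inferInstance, ν, inferInstance, φ, ⟨hφ, ?_⟩, fun g => ?_⟩
  · refine hemb.map_injective ?_
    rw [Measure.map_map hemb.measurable hφ]
    exact (Measure.map_congr hφΨ).trans hmap
  · filter_upwards [hφΨ, (measurePreserving_shift ν g).quasiMeasurePreserving.ae hφΨ, hequiv g]
      with x h1 h3 h4
    refine Subtype.ext ?_
    rw [h3, h4, ← h1]
    rfl

end Annihilator

end AlgAction

end

/-! ### Assembly of the main theorem. -/

open AlgAction in
theorem corollaryC {G : Type*} [Group G] [Countable G]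
    (f : MonoidAlgebra ℤ G) (hf : IsSemiLopsided f)
    (ξ : lp (fun _ : G => ℝ) 2) (hξ : IsL2FormalInverse f ξ)
    (hord : HasPositiveLeftOrder (nonidSupport f))
    (hinf : Infinite
      (Subgroup.closure {g : G | ∃ a ∈ nonidSupport f, ∃ b ∈ nonidSupport f, g = a⁻¹ * b})) :
    (∃ ν : Measure ℝ, IsProbabilityMeasure ν ∧
      (∃ F : Finset ℤ, ν ((fun n : ℤ => (n : ℝ)) '' (F : Set ℤ))ᶜ = 0) ∧
      ∫ t, t ∂ν = 0 ∧
      ∃ Θ : lp (fun _ : G => ℝ) 2 → ((G → ℝ) →ₘ[bernoulli G ν] (G → UnitAddCircle)),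
        IsL2Convolution ν Θ ∧
        (∀ Θ' : lp (fun _ : G => ℝ) 2 → ((G → ℝ) →ₘ[bernoulli G ν] (G → UnitAddCircle)),
          IsL2Convolution ν Θ' → Θ' = Θ) ∧
        (∀ g : G, ∀ᵐ x ∂(bernoulli G ν), Θ ξ (shift g x) = shift g (Θ ξ x)) ∧
        Measure.map (Θ ξ) (bernoulli G ν) = Measure.map Subtype.val (haarX f)) ∧
    IsFactorOfBernoulli G (haarX f) := by
  classical
  obtain ⟨n, hn⟩ : ∃ n : ℕ, f.coeff 1 = n := ⟨_, (Int.toNat_of_nonneg hf.1.le).symm⟩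
  have hn0 : 0 < n := by exact_mod_cast hn ▸ hf.1
  -- Using 2n instead of n keeps the variance positive when f₁ = 1, where `diffLaw 1` would be the
  -- point mass at 0; multiples of 1/n are still multiples of 1/(2n).
  have hν := isProbabilityMeasure_diffLaw (N := 2 * n) (by lia)
  have h2 := memLp_diffLaw (N := 2 * n) (by lia)
  obtain ⟨Z, hZ⟩ := exists_l2_sum (G := G) h2 (integral_id_diffLaw _)
    (integral_sq_diffLaw_ne_zero (by lia))
  have hS := hord.isPointed
  have hξ0 := tendsto_lp_cofinite ξ
  have hX : ∀ᵐ x ∂(bernoulli G (diffLaw (2 * n))), convFun Z ξ x ∈ X f := by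
    -- For α = gf the product αξ is δ_g, so the pairing is x(g) mod ℤ, which is 0 because x(g) is
    -- almost surely an integer.
    have hval (g u : G) : leftMul (MonoidAlgebra.single g 1 * f) ξ u = if u = g then 1 else 0 := by
      rw [leftMul_apply, lconv_single_mul, lconv_self_eq hf hS hξ0 hξ]
      simp [inv_mul_eq_one, eq_comm]
    have hint : ∀ᵐ x ∂(bernoulli G (diffLaw (2 * n))), ∀ g : G, ∃ k : ℤ, x g = (k : ℝ) :=
      ae_all_iff.2 fun g => (measurePreserving_eval_infinitePi
        (fun _ : G => diffLaw (2 * n)) g).quasiMeasurePreserving.ae (ae_diffLaw_int _)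
    have hsum : ∀ᵐ x ∂(bernoulli G (diffLaw (2 * n))), ∀ g : G,
        Z (leftMul (MonoidAlgebra.single g 1 * f) ξ) x = x g := by
      refine ae_all_iff.2 fun g => ?_
      filter_upwards [l2_sum_eq_sum hZ (leftMul (MonoidAlgebra.single g 1 * f) ξ) (s := {g})
        fun k hk => by rw [hval, if_neg (by simpa using hk)]] with x hx
      rw [hx, Finset.sum_singleton, hval, if_pos rfl, one_mul]
    filter_upwards [hint, hsum, ae_all_iff.2 fun g : G =>
      pairing_convFun_ae (Z := Z) (MonoidAlgebra.single g 1 * f) ξ] with x h1 h3 h4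
    refine mem_X_of_forall_single fun g => ?_
    obtain ⟨k, hk⟩ := h1 g
    rw [h4, h3, hk]
    exact (AddCircle.coe_eq_zero_iff 1).2 ⟨k, by simp⟩
  have hcoef : ∀ α ∉ Ideal.span {f},
      ∫ x, character α (convFun Z ξ x) ∂(bernoulli G (diffLaw (2 * n))) = 0 := by
    intro α hα
    obtain ⟨u, m, hm, hdvd⟩ := exists_lconv_mul_eq_intCast hf hS hξ0 hξ hα
    have h1 : ∫ x, character α (convFun Z ξ x) ∂(bernoulli G (diffLaw (2 * n))) =
        ∫ x, (AddCircle.toCircle ((Z (leftMul α ξ) x : ℝ) : UnitAddCircle) : ℂ)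
          ∂(bernoulli G (diffLaw (2 * n))) := by
      refine integral_congr_ae ?_
      filter_upwards [pairing_convFun_ae (Z := Z) α ξ] with x hx
      rw [character_apply, hx]
    rw [h1]
    have hm' : (n : ℝ) * leftMul α ξ u = m := by
      rw [leftMul_apply, ← hm, hn, Int.cast_natCast]
    refine integral_toCircle_l2_sum_eq_zero hZ (leftMul α ξ) (u := u)
      (integral_toCircle_diffLaw (m := 2 * m) ?_ ?_)
    · push_cast
      rw [mul_assoc, hm']
    · intro h0
      obtain ⟨k, hk⟩ := (AddCircle.coe_eq_zero_iff (1 : ℝ)).1 h0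
      refine hdvd ⟨k, ?_⟩
      rw [← hk, zsmul_eq_mul, mul_one] at hm'
      rw [hn]
      exact_mod_cast hm'.symm
  have hmeas : Measurable (convFun Z ξ) := measurable_convFun ξ
  have hmap : Measure.map (convMap Z ξ) (bernoulli G (diffLaw (2 * n))) =
      Measure.map Subtype.val (haarX f) := by
    rw [Measure.map_congr (convMap_ae ξ)]
    have := Measure.isProbabilityMeasure_map (μ := bernoulli G (diffLaw (2 * n)))
      hmeas.aemeasurable
    refine eq_map_haarX ((ae_map_iff hmeas.aemeasurable (measurableSet_X f)).2 hX) fun α hα => ?_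
    rw [integral_map hmeas.aemeasurable (character α).continuous.aestronglyMeasurable]
    exact hcoef α hα
  have hconv := isL2Convolution_convMap hZ
  have hequiv := convMap_shift hZ ξ
  exact ⟨⟨_, hν, exists_finset_diffLaw _, integral_id_diffLaw _, convMap Z, hconv,
    fun _ h => hconv.unique h, hequiv, hmap⟩,
    isFactorOfBernoulli_haarX (AEEqFun.aestronglyMeasurable _).aemeasurable hequiv hmap⟩
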